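/- Let $k\ge 2$ and let $L=\{E\}$ be the language of $k$-uniform hypergraphs, where $E$ is a $k$-ary relation symbol. An $L$-structure is *non-redundant* if $E$ holds only of tuples with pairwise distinct entries. Let $\mathrm{qf}^{\mathrm{nr}}_L$ be the space of complete non-redundant quantifier-free $L$-types in the variables $x_0,\dots,x_{k-1}$, i.e. the maximal sets of atomic and negated atomic formulas in these variables that contain $x_i\ne x_j$ for all $i<j$ and are realized by a tuple in a non-redundant $L$-structure. For $n\in\mathbb N$ write $[n]=\{0,\dots,n-1\}$, and let $\mathfrak P_{<k}(k)$ denote the set of subsets of $[k]$ with fewer than $k$ elements. Let $\lambda$ denote Lebesgue measure on powers of $[0,1]$. A permutation $\sigma$ of $[k]$ acts on a type $u$ by substituting $x_{\sigma(i)}$ for each $x_i$, and on a probability measure $\nu$ on $\mathrm{qf}^{\mathrm{nr}}_L$ by $(\sigma\cdot\nu)(B)=\nu(\{\sigma\cdot u: u\in B\})$. An *extended $L$-hypergraphon* is a measurable map $W$ from $[0,1]^{\mathfrak P_{<k}(k)}$ to the space of probability measures on $\mathrm{qf}^{\mathrm{nr}}_L$ such that $W(\langle x_{\sigma(F)}\rangle_F)=\sigma\cdot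 W(\langle x_F\rangle_F)$ for all $\langle x_F\rangle_F$ and all permutations $\sigma$ of $[k]$. Let $W^*\colon[0,1]^{\mathfrak P_{<k}(k)}\times[0,1]\to\mathrm{qf}^{\mathrm{nr}}_L$ be measurable and such that, for every $t$, the variable $W^*(t,\zeta)$ has distribution $W(t)$ when $\zeta$ is uniform on $[0,1]$ (such a $W^*$ exists). Let $\zeta_D$, for $D\subseteq\mathbb N$ with $|D|\le k$, be independent and uniform on $[0,1]$. Then $G(\mathbb N,W)$ is the random non-redundant $L$-structure on $\mathbb N$ such that, for each $k$-element set $J\subseteq\mathbb N$ with increasing enumeration $\tau_J\colon[k]\to J$, the quantifier-free type of $(\tau_J(0),\dots,\tau_J(k-1))$ is $W^*(\langle\zeta_{\tau_J(F)}\rangle_{F\in\mathfrak P_{<k}(k)},\zeta_J)$. Its distribution does not depend on the choice of $W^*$ and of the $\zeta_D$. The *entropy* of a probability measure $\nu$ is $-\sum_x\nu(\{x\})\log_2\nu(\{x\})$, summed over its atoms $x$, if $\nu$ is purely atomic, and $\infty$ otherwise. The *entropy function* $\mathrm{Ent}(G(\mathbb N,W))$ maps $n\in\mathbb N$ to the entropy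 of the distribution of the restriction of $G(\mathbb N,W)$ to $[n]$. Let $u_\top$ (respectively $u_\bot$) be the non-redundant quantifier-free type containing $E(x_{\sigma(0)},\dots,x_{\sigma(k-1)})$ (respectively its negation) for all permutations $\sigma$ of $[k]$. The extended $L$-hypergraphon $W$ *induces a Borel hypergraph* if - for almost every pair of sequences $x,y\in[0,1]^{\mathfrak P_{<k}(k)}$ with $x_{\{i\}}=y_{\{i\}}$ for all $i\in[k]$, we have $W(x)=W(y)$ (where the common singleton entries and all the other entries of $x$ and of $y$ are independent and uniform); and - for $\lambda$-almost every $x\in[0,1]^{\mathfrak P_{<k}(k)}$, the measure $W(x)$ is the point mass at $u_\top$ or the point mass at $u_\bot$. **Lemma.** If an extended $L$-hypergraphon $W$ induces a Borel hypergraph, then the entropy function of $G(\mathbb N,W)$ takes only finite values, and $$\mathrm{Ent}(G(\mathbb N,W))(n)=o(n^k)\qquad(n\to\infty).$$ -/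

import Mathlib

open FirstOrder FirstOrder.Language MeasureTheory ProbabilityTheory Filter Asymptotics
open scoped ENNReal

/-! ### Structures with a fixed underlying set, and their entropy -/

/-- The space `Str_L(α)` of all `L`-structures with underlying set `α`. -/
def Str (L : FirstOrder.Language.{0, 0}) (α : Type) : Type := L.Structure α

/-- The relation `R` holds of the tuple `t` in the structure `M`. -/
def Str.Holds {L : FirstOrder.Language.{0, 0}} {α : Type} (M : Str L α) {n : ℕ} (R : L.Relations n)
    (t : Fin n → α) : Prop :=
  @Structure.RelMap L α M n R t

/-- The formula `φ` holds in `M` under the assignment `v`. -/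
def Str.Sat {L : FirstOrder.Language.{0, 0}} {α β : Type} (M : Str L α) (φ : L.Formula β)
    (v : β → α) : Prop :=
  @Formula.Realize L α M β φ v

/-- The σ-algebra on `Str_L(α)`, for a relational language, generated by the basic clopen sets of
structures in which a given instance of a relation holds. (For countable `L` and `α` this is the
Borel σ-algebra of the topology generated by the extents of quantifier-free formulas.) -/
instance Str.instMeasurableSpace (L : FirstOrder.Language.{0, 0}) (α : Type) :
    MeasurableSpace (Str L α) :=
  MeasurableSpace.generateFrom
    {B | ∃ (n : ℕ) (R : L.Relations n) (t : Fin n → α), B = {M : Str L α | M.Holds R t}}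

/-- A structure is non-redundant if each relation holds only of tuples with distinct entries. -/
def Str.NonRedundant {L : FirstOrder.Language.{0, 0}} {α : Type} (M : Str L α) : Prop :=
  ∀ (n : ℕ) (R : L.Relations n) (t : Fin n → α), M.Holds R t → Function.Injective t

/-- The restriction `M|_[n]` of a structure on `ℕ` in a relational language to `{0, …, n-1}`. -/
def Str.restrict {L : FirstOrder.Language.{0, 0}} [L.IsRelational] (n : ℕ)
    (M : Str L ℕ) : Str L (Fin n) :=
  show L.Structure (Fin n) from
    { funMap := fun f => isEmptyElim f
      RelMap := fun R t => M.Holds R (fun i => (t i : ℕ)) }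

open Classical in
/-- The entropy `h(ν)`, with values in `[0, ∞]`: `-∑ ν{x} log₂ ν{x}` over the atoms `x` if the
measure is purely atomic, and `∞` otherwise. -/
noncomputable def measureEntropy {S : Type} [MeasurableSpace S] (ν : Measure S) : ℝ≥0∞ :=
  if ν {s | 0 < ν {s}} = 1 then
    ∑' x : {s // 0 < ν {s}}, ENNReal.ofReal (-(ν.real {x.1} * Real.logb 2 (ν.real {x.1})))
  else ⊤

/-- The entropy function of a measure `μ` on `Str_L(ℕ)`: it maps `n` to the entropy of the
distribution `μ_n` of the restriction to `{0, …, n-1}`. -/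
noncomputable def entropyFunction {L : FirstOrder.Language.{0, 0}} [L.IsRelational]
    (μ : Measure (Str L ℕ)) (n : ℕ) : ℝ≥0∞ :=
  measureEntropy (μ.map (Str.restrict n))

/-! ### Quantifier-free types -/

/-- `φ` is an atomic formula or the negation of one. -/
def IsLiteral {L : FirstOrder.Language.{0, 0}} {β : Type} (φ : L.Formula β) : Prop :=
  BoundedFormula.IsAtomic φ ∨ ∃ ψ : L.Formula β, BoundedFormula.IsAtomic ψ ∧ φ = ψ.not

/-- The atomic formula `R(x_{s 0}, …, x_{s (n-1)})`. -/
def relFormula {L : FirstOrder.Language.{0, 0}} {k n : ℕ} (R : L.Relations n) (s : Fin n → Fin k) :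
    L.Formula (Fin k) :=
  R.formula fun i => Term.var (s i)

/-- The formula `x_i = x_j`. -/
def eqFormula {L : FirstOrder.Language.{0, 0}} {k : ℕ} (i j : Fin k) : L.Formula (Fin k) :=
  Term.equal (Term.var i) (Term.var j)

/-- A non-redundant quantifier-free set of conditions on `x_0, …, x_{k-1}`: a set of literals that
contains `x_i ≠ x_j` for `i < j` and is realized by some tuple in some non-redundant structure. -/
def IsPartialQfType (L : FirstOrder.Language.{0, 0}) (k : ℕ) (u : Set (L.Formula (Fin k))) : Prop :=
  (∀ φ ∈ u, IsLiteral φ) ∧ (∀ i j : Fin k, i < j → (eqFormula i j).not ∈ u) ∧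
    ∃ (A : Type) (M : Str L A) (v : Fin k → A), M.NonRedundant ∧ ∀ φ ∈ u, M.Sat φ v

/-- The space of complete non-redundant quantifier-free `L`-types in `x_0, …, x_{k-1}`. -/
def QfType (L : FirstOrder.Language.{0, 0}) (k : ℕ) : Type :=
  {u : Set (L.Formula (Fin k)) // Maximal (IsPartialQfType L k) u}

/-- The σ-algebra generated by the subbasic clopen sets of types containing a given formula. -/
instance QfType.instMeasurableSpace (L : FirstOrder.Language.{0, 0}) (k : ℕ) :
    MeasurableSpace (QfType L k) :=
  MeasurableSpace.generateFrom
    {B | ∃ φ : L.Formula (Fin k), B = {u : QfType L k | φ ∈ u.1}}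

/-- The set of formulas `σ · u`, obtained by substituting `x_{σ i}` for each `x_i`. -/
def permFormulas {L : FirstOrder.Language.{0, 0}} {k : ℕ} (σ : Equiv.Perm (Fin k))
    (u : Set (L.Formula (Fin k))) : Set (L.Formula (Fin k)) :=
  (BoundedFormula.relabelEquiv σ : L.Formula (Fin k) ≃ L.Formula (Fin k)) '' u

/-! ### Extended hypergraphons and sampling -/

/-- `𝔓_{<k}(k)`: the subsets of `{0, …, k-1}` with fewer than `k` elements. -/
abbrev SmallSubset (k : ℕ) : Type := {F : Finset (Fin k) // F.card < k}

/-- `𝔓_{≤k}(ℕ)`: the sets of at most `k` natural numbers. -/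
abbrev NatSubset (k : ℕ) : Type := {D : Finset ℕ // D.card ≤ k}

/-- The image `σ(F)` of a proper subset under a permutation. -/
def SmallSubset.perm {k : ℕ} (σ : Equiv.Perm (Fin k)) (F : SmallSubset k) : SmallSubset k :=
  ⟨F.1.map σ.toEmbedding, by rw [Finset.card_map]; exact F.2⟩

/-- An extended `L`-hypergraphon (for `L` relational with all relations of arity `k`): a measurable
map from `[0,1]^{𝔓_{<k}(k)}` to the probability measures on quantifier-free types, such that
`W(⟨x_{σ(F)}⟩) = σ · W(⟨x_F⟩)`, where `(σ · ν)(B) = ν {σ · u | u ∈ B}`. -/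
structure ExtHypergraphon (L : FirstOrder.Language.{0, 0}) (k : ℕ) where
  /-- the underlying probability kernel -/
  kernel : Kernel (SmallSubset k → unitInterval) (QfType L k)
  isMarkov : IsMarkovKernel kernel
  coherent : ∀ (x : SmallSubset k → unitInterval) (σ : Equiv.Perm (Fin k)) (B : Set (QfType L k)),
    MeasurableSet B →
      kernel (fun F => x (F.perm σ)) B = kernel x {v | ∃ u ∈ B, v.1 = permFormulas σ u.1}

/-- `f` is a function `W*` representing `W`: it is measurable, and if `ζ` is uniform in `[0,1]` then
`W*(t, ζ)` has distribution `W(t)`, for every `t`. -/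
def ExtHypergraphon.IsRepresentedBy {L : FirstOrder.Language.{0, 0}} {k : ℕ}
    (W : ExtHypergraphon L k) (f : (SmallSubset k → unitInterval) → unitInterval → QfType L k) : Prop :=
  Measurable (Function.uncurry f) ∧ ∀ t, (volume : Measure unitInterval).map (f t) = W.kernel t

/-- The image `τ_J(F)` of `F` under the increasing bijection `τ_J : {0, …, k-1} → J`. -/
def tauImage {k : ℕ} (J : Finset ℕ) (hJ : J.card = k) (F : SmallSubset k) : NatSubset k :=
  ⟨F.1.map (J.orderEmbOfFin hJ).toEmbedding, by rw [Finset.card_map]; exact F.2.le⟩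

/-- The structure `M(ℕ, W)(x)` on `ℕ`: for each `k`-element set `J`, the quantifier-free type of the
increasing enumeration `τ_J` of `J` is `W*(x̂_J, x_J)`. As these types are non-redundant, and so is
the structure, `R` holds of a tuple exactly if the tuple is of the form `τ_J ∘ s` with
`R(x_{s 0}, …)` in the type attached to `J`. -/
def sampleStructure {L : FirstOrder.Language.{0, 0}} [L.IsRelational] {k : ℕ}
    (f : (SmallSubset k → unitInterval) → unitInterval → QfType L k)
    (x : NatSubset k → unitInterval) : Str L ℕ :=
  show L.Structure ℕ from
    { funMap := fun g => isEmptyElim g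
      RelMap := fun {n} R t =>
        ∃ (J : Finset ℕ) (hJ : J.card = k) (s : Fin n → Fin k),
          (∀ i, t i = J.orderEmbOfFin hJ (s i)) ∧
            relFormula R s ∈ (f (fun F => x (tauImage J hJ F)) (x ⟨J, hJ.le⟩)).1 }

/-- The distribution of `G(ℕ, W)`, the structure sampled from i.i.d. uniform variables `ζ_D`, one for
each set `D` of at most `k` natural numbers. It is written in terms of `W*`. -/
noncomputable def sampleLaw {L : FirstOrder.Language.{0, 0}} [L.IsRelational] {k : ℕ}
    (f : (SmallSubset k → unitInterval) → unitInterval → QfType L k) : Measure (Str L ℕ) :=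
  (Measure.infinitePi fun _ : NatSubset k => (volume : Measure unitInterval)).map (sampleStructure f)

/-! ### Hypergraphs -/

/-- The relation symbols of the language of `k`-uniform hypergraphs: one symbol, of arity `k`. -/
inductive HypergraphRel (k : ℕ) : ℕ → Type
  | edge : HypergraphRel k k

/-- The language `{E}` of `k`-uniform hypergraphs. -/
def hypergraphLang (k : ℕ) : FirstOrder.Language.{0, 0} := ⟨fun _ => Empty, HypergraphRel k⟩

instance hypergraphLang.instIsRelational (k : ℕ) : (hypergraphLang k).IsRelational :=
  fun _ => inferInstanceAs (IsEmpty Empty)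

/-- The relation symbol `E`. -/
def edgeSymbol (k : ℕ) : (hypergraphLang k).Relations k := HypergraphRel.edge

/-- `u` is the type `u_⊤`, which contains `E(x_{σ 0}, …, x_{σ (k-1)})` for all permutations `σ`. -/
def IsTopType {k : ℕ} (u : QfType (hypergraphLang k) k) : Prop :=
  ∀ σ : Equiv.Perm (Fin k), relFormula (edgeSymbol k) σ ∈ u.1

/-- `u` is the type `u_⊥`, which contains `¬ E(x_{σ 0}, …, x_{σ (k-1)})` for all permutations `σ`. -/
def IsBotType {k : ℕ} (u : QfType (hypergraphLang k) k) : Prop :=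
  ∀ σ : Equiv.Perm (Fin k), (relFormula (edgeSymbol k) σ).not ∈ u.1

/-- `W` induces a Borel hypergraph: almost everywhere `W` depends only on the variables `x_{i}`
indexed by singletons, and almost everywhere it is the point mass at `u_⊤` or at `u_⊥`. In the first
condition the pair of sequences is `x` and the sequence with the singleton entries of `x` and all
other entries taken from an independent `y`. -/
def ExtHypergraphon.InducesBorelHypergraph {k : ℕ} (W : ExtHypergraphon (hypergraphLang k) k) :
    Prop :=
  (∀ᵐ p : (SmallSubset k → unitInterval) × (SmallSubset k → unitInterval),
    W.kernel p.1 = W.kernel (fun F => if F.1.card = 1 then p.1 F else p.2 F)) ∧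
  (∀ᵐ x : SmallSubset k → unitInterval,
    ∃ u : QfType (hypergraphLang k) k, (IsTopType u ∨ IsBotType u) ∧
      W.kernel x = Measure.dirac u)

/-! ### Types are realized, and representing functions `W*` exist -/

/-- The set of literals that hold of the tuple `v` in `M`. -/
def Str.qfSet {L : FirstOrder.Language.{0, 0}} {A : Type} {k : ℕ} (M : Str L A) (v : Fin k → A) :
    Set (L.Formula (Fin k)) := {φ | IsLiteral φ ∧ M.Sat φ v}

theorem Str.sat_not {L : FirstOrder.Language.{0, 0}} {α β : Type} (M : Str L α) (φ : L.Formula β)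
    (v : β → α) : M.Sat φ.not v ↔ ¬ M.Sat φ v := Iff.rfl

theorem Str.sat_rel {L : FirstOrder.Language.{0, 0}} {α : Type} (M : Str L α) {k n : ℕ}
    (R : L.Relations n) (s : Fin n → Fin k) (v : Fin k → α) :
    M.Sat (relFormula R s) v ↔ M.Holds R (v ∘ s) := by
  let : L.Structure α := M
  exact Formula.realize_rel

theorem Str.sat_eq {L : FirstOrder.Language.{0, 0}} {α : Type} (M : Str L α) {k : ℕ}
    (i j : Fin k) (v : Fin k → α) : M.Sat (eqFormula i j : L.Formula (Fin k)) v ↔ v i = v j := by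
  let : L.Structure α := M
  exact Formula.realize_equal

theorem maximal_qfSet {L : FirstOrder.Language.{0, 0}} {A : Type} {k : ℕ} (M : Str L A)
    (hM : M.NonRedundant) (v : Fin k → A) (hv : Function.Injective v) :
    Maximal (IsPartialQfType L k) (M.qfSet v) := by
  refine ⟨⟨fun φ h => h.1, fun i j hij => ⟨Or.inr ⟨_, .equal _ _, rfl⟩, ?_⟩, A, M, v, hM,
    fun φ h => h.2⟩, ?_⟩
  · rw [Str.sat_not, Str.sat_eq]
    exact fun h => hij.ne (hv h)
  · rintro u ⟨hu, -, A', M', v', -, h'⟩ hle φ hφ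
    refine ⟨hu φ hφ, ?_⟩
    by_contra hn
    rcases hu φ hφ with ha | ⟨ψ, ha, rfl⟩
    · exact (h' _ (hle (show φ.not ∈ M.qfSet v from ⟨Or.inr ⟨φ, ha, rfl⟩, hn⟩))) (h' _ hφ)
    · rw [Str.sat_not, not_not] at hn
      exact (h' _ hφ) (h' _ (hle (show ψ ∈ M.qfSet v from ⟨Or.inl ha, hn⟩)))

theorem QfType.exists_realization {L : FirstOrder.Language.{0, 0}} {k : ℕ} (u : QfType L k) :
    ∃ (A : Type) (M : Str L A) (v : Fin k → A), M.NonRedundant ∧ Function.Injective v ∧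
      u.1 = M.qfSet v := by
  obtain ⟨u, hu⟩ := u
  obtain ⟨h1, h2, A, M, v, hM, h⟩ := hu.prop
  have hv : Function.Injective v := by
    intro i j hij
    by_contra hne
    rcases lt_or_gt_of_ne hne with hlt | hlt
    · exact (h _ (h2 _ _ hlt)) ((Str.sat_eq M i j v).2 hij)
    · exact (h _ (h2 _ _ hlt)) ((Str.sat_eq M j i v).2 hij.symm)
  exact ⟨A, M, v, hM, hv, hu.eq_of_subset (maximal_qfSet M hM v hv).prop
    fun φ hφ => ⟨h1 φ hφ, h φ hφ⟩⟩

theorem isAtomic_cases {L : FirstOrder.Language.{0, 0}} [L.IsRelational] {k : ℕ}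
    {φ : L.Formula (Fin k)} (h : BoundedFormula.IsAtomic φ) :
    (∃ i j, φ = eqFormula i j) ∨ ∃ (n : ℕ) (R : L.Relations n) (s : Fin n → Fin k),
      φ = relFormula R s := by
  have key : ∀ t : L.Term (Fin k ⊕ Fin 0), ∃ i : Fin k, t = Term.var (Sum.inl i) := by
    rintro (x | ⟨f, -⟩)
    · rcases x with i | i
      · exact ⟨i, rfl⟩
      · exact i.elim0
    · exact isEmptyElim f
  cases h with
  | equal t₁ t₂ =>
    obtain ⟨i, rfl⟩ := key t₁
    obtain ⟨j, rfl⟩ := key t₂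
    exact Or.inl ⟨i, j, rfl⟩
  | rel R ts =>
    choose s hs using fun i => key (ts i)
    obtain rfl : ts = fun i => Term.var (Sum.inl (s i)) := funext hs
    exact Or.inr ⟨_, R, s, rfl⟩

/-- A type is determined by the relation instances it contains. -/
theorem QfType.ext_rel {L : FirstOrder.Language.{0, 0}} [L.IsRelational] {k : ℕ} {u v : QfType L k}
    (h : ∀ (n : ℕ) (R : L.Relations n) (s : Fin n → Fin k),
      relFormula R s ∈ u.1 ↔ relFormula R s ∈ v.1) : u = v := by
  obtain ⟨A, M, a, -, ha, hu⟩ := u.exists_realization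
  obtain ⟨B, N, b, -, hb, hv⟩ := v.exists_realization
  have hat : ∀ φ : L.Formula (Fin k), BoundedFormula.IsAtomic φ → (M.Sat φ a ↔ N.Sat φ b) := by
    intro φ hφ
    rcases isAtomic_cases hφ with ⟨i, j, rfl⟩ | ⟨n, R, s, rfl⟩
    · rw [Str.sat_eq, Str.sat_eq, ha.eq_iff, hb.eq_iff]
    · have := h n R s
      rw [hu, hv] at this
      have hl : IsLiteral (relFormula R s : L.Formula (Fin k)) := Or.inl hφ
      exact ⟨fun q => (this.1 ⟨hl, q⟩).2, fun q => (this.2 ⟨hl, q⟩).2⟩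
  refine Subtype.ext ?_
  rw [hu, hv]
  ext φ
  refine and_congr_right fun hl => ?_
  rcases hl with h | ⟨ψ, h, rfl⟩
  · exact hat φ h
  · rw [Str.sat_not, Str.sat_not, hat ψ h]

theorem QfType.measurableSet_mem {L : FirstOrder.Language.{0, 0}} {k : ℕ} (φ : L.Formula (Fin k)) :
    MeasurableSet {u : QfType L k | φ ∈ u.1} :=
  MeasurableSpace.measurableSet_generateFrom ⟨φ, rfl⟩

theorem QfType.ext_edge {k : ℕ} {u v : QfType (hypergraphLang k) k}
    (h : ∀ s : Fin k → Fin k, relFormula (edgeSymbol k) s ∈ u.1 ↔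
      relFormula (edgeSymbol k) s ∈ v.1) : u = v := by
  refine QfType.ext_rel fun n R s => ?_
  cases R
  exact h s

instance QfType.instFinite (k : ℕ) : Finite (QfType (hypergraphLang k) k) :=
  Finite.of_injective
    (fun u : QfType (hypergraphLang k) k => {s : Fin k → Fin k | relFormula (edgeSymbol k) s ∈ u.1})
    fun _ _ huv => QfType.ext_edge fun s => Set.ext_iff.1 huv s

instance QfType.instMeasurableSingleton (k : ℕ) :
    MeasurableSingletonClass (QfType (hypergraphLang k) k) where
  measurableSet_singleton u := by
    have : {u} = ⋂ s : Fin k → Fin k, {v : QfType (hypergraphLang k) k |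
        relFormula (edgeSymbol k) s ∈ v.1 ↔ relFormula (edgeSymbol k) s ∈ u.1} := by
      ext v
      simp only [Set.mem_singleton_iff, Set.mem_iInter, Set.mem_ofPred_eq]
      exact ⟨fun h s => by rw [h], QfType.ext_edge⟩
    rw [this]
    refine MeasurableSet.iInter fun s => ?_
    by_cases hs : relFormula (edgeSymbol k) s ∈ u.1
    · simp only [hs, iff_true]
      exact QfType.measurableSet_mem _
    · simp only [hs, iff_false]
      exact (QfType.measurableSet_mem _).compl

/-- A measurable `W*` exists. -/
theorem ExtHypergraphon.exists_isRepresentedBy {k : ℕ} (W : ExtHypergraphon (hypergraphLang k) k) :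
    ∃ f : (SmallSubset k → unitInterval) → unitInterval → QfType (hypergraphLang k) k,
      W.IsRepresentedBy f := by
  have := W.isMarkov
  have : Nonempty (QfType (hypergraphLang k) k) :=
    (nonempty_of_isProbabilityMeasure (W.kernel fun _ => 0))
  exact Kernel.exists_measurable_map_eq_unitInterval W.kernel

/-! The edges of the sampled hypergraph are almost surely a function of the `n` vertex variables,
through one measurable relation `A` on `[0,1]`. Such a relation is nearly finite: up to measure `ε`
it depends only on the classes of its arguments in a finite measurable partition. The restriction to
`[n]` can thus be recovered from the classes of the `n` vertices, at a cost of `O(n)` bits, together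
with the set of exceptional `k`-sets, on which the prediction from the classes is wrong. Each
`k`-set is exceptional with probability at most `ε`, so listing the exceptions costs about `n.choose
k` times the binary entropy of `ε`. Since `k ≥ 2` and the binary entropy tends to `0` with `ε`, the
total is `o(n^k)`.

The cost is measured by Gibbs' inequality (`measureEntropy_map_le_of_weights`) against a product
weight on codes. Exceptions for overlapping sets are dependent, but only the mean of the negative
log-weight enters, so their marginal probabilities suffice. The other ingredients are
`exists_vertex_relation`, `exists_finite_partition_approx` and
`restrict_sampleStructure_eq_decodeHypergraph`; `entropyFunction_sampleLaw_le` combines them. -/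

/-! ### A coding bound for the entropy -/

/-- Gibbs' inequality for the image of a finite distribution `p` under `Φ`, with weights `w` on the
source. -/
theorem sum_entropy_le_of_weights {T S : Type*} [Fintype T] [Fintype S] [DecidableEq S]
    (Φ : T → S) (p w : T → ℝ) (ν : S → ℝ) (hp : ∀ t, 0 ≤ p t) (hp1 : ∑ t, p t = 1)
    (hw : ∀ t, 0 < w t) (hw1 : ∑ t, w t ≤ 1) (hν : ∀ s, ν s = ∑ t with Φ t = s, p t) :
    ∑ s, -(ν s * Real.logb 2 (ν s)) ≤ ∑ t, p t * -Real.logb 2 (w t) := by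
  have hle : ∀ t, p t ≤ ν (Φ t) := fun t => by
    rw [hν]
    exact Finset.single_le_sum (f := p) (fun i _ => hp i) (by simp)
  have hfib : ∑ s, -(ν s * Real.logb 2 (ν s)) = ∑ t, p t * -Real.logb 2 (ν (Φ t)) := by
    rw [← Finset.sum_fiberwise (s := Finset.univ) (g := Φ)]
    refine Finset.sum_congr rfl fun s _ => ?_
    rw [Finset.sum_congr rfl (g := fun t => p t * -Real.logb 2 (ν s)) fun t ht => by
      rw [(Finset.mem_filter.1 ht).2], ← Finset.sum_mul, ← hν]
    ring
  -- This is `log y ≤ y - 1` at `y = w t / ν (Φ t)`, followed by `p t ≤ ν (Φ t)`. The case `p t = 0`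
  -- is separate because `ν (Φ t)` may then vanish.
  have hterm : ∀ t, p t * (Real.log (w t) - Real.log (ν (Φ t))) ≤ w t - p t := by
    intro t
    rcases (hp t).eq_or_lt with h | h
    · rw [← h]; simpa using (hw t).le
    · have hpos : 0 < ν (Φ t) := h.trans_le (hle t)
      rw [← Real.log_div (hw t).ne' hpos.ne']
      calc p t * Real.log (w t / ν (Φ t)) ≤ p t * (w t / ν (Φ t) - 1) :=
            mul_le_mul_of_nonneg_left (Real.log_le_sub_one_of_pos (div_pos (hw t) hpos)) h.le
        _ = w t * (p t / ν (Φ t)) - p t := by ring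
        _ ≤ w t - p t := by
            have := mul_le_mul_of_nonneg_left ((div_le_one hpos).2 (hle t)) (hw t).le
            linarith
  have hsum : ∑ t, p t * (Real.log (w t) - Real.log (ν (Φ t))) ≤ 0 := by
    refine (Finset.sum_le_sum fun t _ => hterm t).trans ?_
    rw [Finset.sum_sub_distrib, hp1]
    linarith
  rw [hfib, ← sub_nonpos, ← Finset.sum_sub_distrib]
  have : ∑ t, (p t * -Real.logb 2 (ν (Φ t)) - p t * -Real.logb 2 (w t)) =
      (∑ t, p t * (Real.log (w t) - Real.log (ν (Φ t)))) / Real.log 2 := by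
    rw [Finset.sum_div]
    refine Finset.sum_congr rfl fun t _ => ?_
    rw [Real.logb, Real.logb]
    ring
  rw [this]
  exact div_nonpos_of_nonpos_of_nonneg hsum (Real.log_nonneg one_le_two)

theorem measureEntropy_eq_ofReal_sum {S : Type} [MeasurableSpace S] [Fintype S]
    [MeasurableSingletonClass S] (ν : Measure S) [IsProbabilityMeasure ν] :
    measureEntropy ν = ENNReal.ofReal (∑ s, -(ν.real {s} * Real.logb 2 (ν.real {s}))) := by
  classical
  have hatom : ν {s | 0 < ν {s}} = 1 := by
    rw [prob_compl_eq_zero_iff (Set.toFinite _).measurableSet |>.symm]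
    rw [← Set.biUnion_of_singleton {s | 0 < ν {s}}ᶜ, measure_biUnion_null_iff (Set.to_countable _)]
    intro s hs
    simpa using hs
  have hnonneg : ∀ s, 0 ≤ -(ν.real {s} * Real.logb 2 (ν.real {s})) := fun s => by
    rw [← mul_neg]
    exact mul_nonneg measureReal_nonneg
      (neg_nonneg.2 (Real.logb_nonpos one_lt_two measureReal_nonneg measureReal_le_one))
  rw [measureEntropy, if_pos hatom, ENNReal.ofReal_sum_of_nonneg fun s _ => hnonneg s,
    ← tsum_fintype (L := .unconditional S)]
  refine tsum_subtype_eq_of_support_subset (s := {s | 0 < ν {s}})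
    (f := fun s => ENNReal.ofReal (-(ν.real {s} * Real.logb 2 (ν.real {s})))) fun s hs => ?_
  rw [Set.mem_ofPred_eq, pos_iff_ne_zero]
  -- Points of measure zero contribute nothing, since the product in the summand has a factor `0`.
  intro h0
  exact hs (by simp [measureReal_def, h0])

/-- The entropy of the image under `Φ` of the distribution of `Y` is at most the mean of
`-log₂ w(Y)`, if `w` is a positive weight of total mass at most `1`. -/
theorem measureEntropy_map_le_of_weights {Ω : Type*} {T S : Type} [MeasurableSpace Ω]
    (P : Measure Ω) [IsProbabilityMeasure P]
    [MeasurableSpace T] [Fintype T] [MeasurableSingletonClass T]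
    [MeasurableSpace S] [Finite S] [MeasurableSingletonClass S]
    (Y : Ω → T) (hY : Measurable Y) (Φ : T → S) (X : Ω → S) (hX : X =ᵐ[P] Φ ∘ Y) (w : T → ℝ)
    (hw : ∀ t, 0 < w t) (hw1 : ∑ t, w t ≤ 1) :
    measureEntropy (P.map X) ≤ ENNReal.ofReal (∫ ω, -Real.logb 2 (w (Y ω)) ∂P) := by
  classical
  have := Fintype.ofFinite S
  have hΦ : Measurable Φ := measurable_of_finite Φ
  have := Measure.isProbabilityMeasure_map (μ := P) hY.aemeasurable
  have := Measure.isProbabilityMeasure_map (μ := P) (hΦ.comp hY).aemeasurable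
  rw [Measure.map_congr hX, measureEntropy_eq_ofReal_sum]
  refine ENNReal.ofReal_le_ofReal ?_
  rw [← integral_map (φ := Y) (f := fun t => -Real.logb 2 (w t)) hY.aemeasurable
    (measurable_of_finite _).aestronglyMeasurable, integral_fintype .of_finite]
  refine sum_entropy_le_of_weights Φ (fun t => (P.map Y).real {t}) w _
    (fun t => measureReal_nonneg) ?_ hw hw1 fun s => ?_
  · simp
  · rw [← Measure.map_map hΦ hY, map_measureReal_apply hΦ (measurableSet_singleton s),
      sum_measureReal_singleton]
    congr 1
    ext t
    simp

/-! ### Approximation of measurable sets in a finite power by finite partitions -/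

open scoped symmDiff in
/-- A measurable subset of `X^ι` is approximated by sets that are determined by finitely many
measurable pieces of `X`. -/
theorem exists_finite_partition_approx {ι X : Type} [Finite ι] [MeasurableSpace X]
    (μ : Measure (ι → X)) [IsFiniteMeasure μ] {A : Set (ι → X)} (hA : MeasurableSet A)
    {ε : ℝ≥0∞} (hε : 0 < ε) :
    ∃ (α : Type) (_ : Finite α) (_ : Nonempty α) (c : X → α) (B : Set (ι → α)),
      (∀ s, MeasurableSet (c ⁻¹' s)) ∧ μ ({v | c ∘ v ∈ B} ∆ A) < ε := by
  have hmeas : ∀ {α : Type} [Finite α] {c : X → α} (B : Set (ι → α)),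
      (∀ s, MeasurableSet (c ⁻¹' s)) → MeasurableSet {v : ι → X | c ∘ v ∈ B} := by
    intro α _ c B hc
    let : MeasurableSpace α := ⊤
    have h : Measurable fun v : ι → X => c ∘ v :=
      measurable_pi_lambda _ fun i =>
        (show Measurable c from fun s _ => hc s).comp (measurable_pi_apply i)
    exact h (Set.toFinite B).measurableSet
  let C : Set (Set (ι → X)) := {t | ∃ (α : Type) (_ : Finite α) (_ : Nonempty α) (c : X → α)
    (B : Set (ι → α)), (∀ s, MeasurableSet (c ⁻¹' s)) ∧ t = {v | c ∘ v ∈ B}}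
  -- The product map `(c, d)` is the common refinement of two partitions, so `C` is closed under
  -- every binary Boolean operation.
  have hcomb : ∀ (op : Prop → Prop → Prop) {s t : Set (ι → X)}, s ∈ C → t ∈ C →
      {v | op (v ∈ s) (v ∈ t)} ∈ C := by
    rintro op _ _ ⟨α, _, _, c, B, hc, rfl⟩ ⟨β, _, _, d, D, hd, rfl⟩
    refine ⟨α × β, inferInstance, inferInstance, fun x => (c x, d x),
      {q | op ((fun i => (q i).1) ∈ B) ((fun i => (q i).2) ∈ D)}, fun s => ?_, rfl⟩
    let : MeasurableSpace α := ⊤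
    let : MeasurableSpace β := ⊤
    exact ((show Measurable c from fun s _ => hc s).prodMk
      (show Measurable d from fun s _ => hd s)) (Set.toFinite s).measurableSet
  have huniv : Set.univ ∈ C :=
    ⟨Unit, inferInstance, inferInstance, fun _ => (), Set.univ, fun s => .const _, rfl⟩
  have hring : IsSetRing C :=
    { empty_mem := ⟨Unit, inferInstance, inferInstance, fun _ => (), ∅, fun s => .const _, rfl⟩
      union_mem := fun _ _ hs ht => hcomb (fun a b => a ∨ b) hs ht
      sdiff_mem := fun _ _ hs ht => hcomb (fun a b => a ∧ ¬ b) hs ht }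
  have hgen : (inferInstance : MeasurableSpace (ι → X)) = MeasurableSpace.generateFrom C := by
    refine le_antisymm (iSup_le fun i => ?_) (MeasurableSpace.generateFrom_le ?_)
    · rintro _ ⟨s, hs, rfl⟩
      -- A set depending on one coordinate comes from the partition of `X` into `s` and its
      -- complement, with `Prop` as the two-element set of labels.
      refine MeasurableSpace.measurableSet_generateFrom
        ⟨Prop, inferInstance, inferInstance, fun x => x ∈ s, {q | q i}, fun t => ?_, rfl⟩
      exact measurableSet_preimage (measurable_mem.2 hs) (Set.toFinite t).measurableSet
    · rintro _ ⟨α, _, _, c, B, hc, rfl⟩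
      exact hmeas B hc
  obtain ⟨_, ⟨α, hα, hα', c, B, hc, rfl⟩, ht⟩ :=
    exists_measure_symmDiff_lt_of_generateFrom_isSetRing (μ := μ) hring
      ⟨{Set.univ}, Set.countable_singleton _, by simpa using huniv, by simp⟩ hgen hA hε
  exact ⟨α, hα, hα', c, B, hc, ht⟩

/-! ### Injective reindexing of product measures -/

theorem map_comp_infinitePi_of_injective {ι κ X : Type*} [MeasurableSpace X] [Fintype κ]
    (μ : Measure X) [IsProbabilityMeasure μ] {e : κ → ι} (he : Function.Injective e) :
    (Measure.infinitePi fun _ : ι => μ).map (fun x i => x (e i)) = Measure.pi fun _ => μ := by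
  rw [← Measure.infinitePi_eq_pi]
  exact Measure.map_infinitePi_infinitePi_of_inj (P := fun _ : ι => μ) he

/-- Adjoining `a` to the family as the value at `none` gives an injective family indexed by `Option
κ`, to which the previous lemma applies. -/
theorem map_comp_prodMk_infinitePi_of_injective {ι κ X : Type*} [MeasurableSpace X] [Fintype κ]
    (μ : Measure X) [IsProbabilityMeasure μ] {e : κ → ι} (he : Function.Injective e) {a : ι}
    (ha : ∀ i, e i ≠ a) :
    (Measure.infinitePi fun _ : ι => μ).map (fun x => ((fun i => x (e i)), x a)) =
      (Measure.pi fun _ : κ => μ).prod μ := by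
  have he' : Function.Injective fun o : Option κ => o.elim a e := by
    rintro (_ | i) (_ | j) h
    · rfl
    · exact (ha j h.symm).elim
    · exact (ha i h).elim
    · exact congrArg some (he h)
  have h := Measure.pi_map_piOptionEquivProd (β := fun _ : Option κ => X) fun _ => μ
  rw [← map_comp_infinitePi_of_injective μ he'] at h
  replace h := congrArg (Measure.map (MeasurableEquiv.piOptionEquivProd fun _ : Option κ => X)) h
  rw [MeasurableEquiv.map_map_symm, Measure.map_map (MeasurableEquiv.measurable _) (by fun_prop)] at h
  exact h.symm

/-! ### Extended hypergraphons that induce a Borel hypergraph -/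

/-- The singleton `{i}`, as a subset of `{0, …, k-1}` with fewer than `k` elements. -/
def SmallSubset.singleton {k : ℕ} (hk : 2 ≤ k) (i : Fin k) : SmallSubset k :=
  ⟨{i}, by rw [Finset.card_singleton]; omega⟩

/-- Non-redundancy excludes `s` that are not injective, and a realized type cannot contain a formula
and its negation. -/
theorem QfType.relFormula_edge_mem_iff {k : ℕ} {u : QfType (hypergraphLang k) k}
    (hu : IsTopType u ∨ IsBotType u) (s : Fin k → Fin k) :
    relFormula (edgeSymbol k) s ∈ u.1 ↔ Function.Bijective s ∧ IsTopType u := by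
  obtain ⟨A, M, v, hM, hv, huv⟩ := u.exists_realization
  have hinj : relFormula (edgeSymbol k) s ∈ u.1 → Function.Bijective s := fun h => by
    rw [huv] at h
    exact Finite.injective_iff_bijective.1
      (Function.Injective.of_comp (hM _ _ _ ((M.sat_rel _ _ _).1 h.2)))
  refine ⟨fun h => ⟨hinj h, hu.resolve_right fun hb => ?_⟩, fun h => ?_⟩
  · have h' := hb (Equiv.ofBijective s (hinj h))
    rw [huv] at h h'
    exact h'.2 h.2
  · exact h.2 (Equiv.ofBijective s h.1)

theorem QfType.measurableSet_of_hypergraphLang {k : ℕ} (B : Set (QfType (hypergraphLang k) k)) :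
    MeasurableSet B :=
  (Set.toFinite B).measurableSet

/-- If `W` induces a Borel hypergraph, then there is a measurable `k`-ary relation `A` on `[0,1]`
such that `W` is almost everywhere the point mass at `u_⊤` or `u_⊥`, depending on whether the
singleton entries are in `A`. -/
theorem ExtHypergraphon.InducesBorelHypergraph.exists_vertex_relation {k : ℕ} (hk : 2 ≤ k)
    {W : ExtHypergraphon (hypergraphLang k) k} (hW : W.InducesBorelHypergraph) :
    ∃ A : Set (Fin k → unitInterval), MeasurableSet A ∧
      ∀ᵐ x : SmallSubset k → unitInterval, ∃ u : QfType (hypergraphLang k) k,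
        (IsTopType u ∨ IsBotType u) ∧ W.kernel x = Measure.dirac u ∧
          (IsTopType u ↔ (fun i => x (SmallSubset.singleton hk i)) ∈ A) := by
  classical
  obtain ⟨h1, h2⟩ := hW
  let T : Set (SmallSubset k → unitInterval) := {x | W.kernel x {u | IsTopType u} = 1}
  have hT : MeasurableSet T :=
    W.kernel.measurable_coe (QfType.measurableSet_of_hypergraphLang _) (measurableSet_singleton 1)
  -- By Fubini, some fixed `y` can supply all non-singleton entries without changing `W.kernel x`
  -- for almost every `x`. The relation `A` is then the section of `T` at this `y`.
  obtain ⟨y, hy⟩ := (Measure.ae_ae_of_ae_prod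
    (Measure.measurePreserving_swap.quasiMeasurePreserving.ae h1)).exists
  let mix : (Fin k → unitInterval) → SmallSubset k → unitInterval := fun v F =>
    if h : ∃ i, F.1 = {i} then v h.choose else y F
  have hmix : Measurable mix := by
    refine measurable_pi_lambda _ fun F => ?_
    by_cases h : ∃ i, F.1 = {i}
    · simp only [mix, dif_pos h]
      fun_prop
    · simp only [mix, dif_neg h]
      fun_prop
  refine ⟨mix ⁻¹' T, hmix hT, ?_⟩
  filter_upwards [h2, hy] with x ⟨u, hu, hx⟩ hxy
  refine ⟨u, hu, hx, ?_⟩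
  have hxmix : (fun F : SmallSubset k => if F.1.card = 1 then x F else y F) =
      mix fun i => x (SmallSubset.singleton hk i) := by
    funext F
    by_cases h : ∃ i, F.1 = {i}
    · have hF : SmallSubset.singleton hk h.choose = F := Subtype.ext h.choose_spec.symm
      simp only [mix, dif_pos h, if_pos (Finset.card_eq_one.2 h), hF]
    · simp only [mix, dif_neg h, if_neg (mt Finset.card_eq_one.1 h)]
  rw [Set.mem_preimage, ← hxmix]
  replace hxy : W.kernel x = W.kernel fun F => if F.1.card = 1 then x F else y F := hxy
  change _ ↔ W.kernel (fun F => if F.1.card = 1 then x F else y F) _ = 1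
  rw [← hxy, hx, Measure.dirac_apply' _ (QfType.measurableSet_of_hypergraphLang _)]
  by_cases htop : IsTopType u <;> simp [htop]

/-- Where `W` is a point mass at `u`, the variable `W*(x, ζ)` is almost surely `u`; Fubini carries
the description of `W` over to `W*`. -/
theorem ExtHypergraphon.IsRepresentedBy.ae_isTopType_iff {k : ℕ} (hk : 2 ≤ k)
    {W : ExtHypergraphon (hypergraphLang k) k}
    {f : (SmallSubset k → unitInterval) → unitInterval → QfType (hypergraphLang k) k}
    (hf : W.IsRepresentedBy f) {A : Set (Fin k → unitInterval)} (hA : MeasurableSet A)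
    (h : ∀ᵐ x : SmallSubset k → unitInterval, ∃ u : QfType (hypergraphLang k) k,
        (IsTopType u ∨ IsBotType u) ∧ W.kernel x = Measure.dirac u ∧
          (IsTopType u ↔ (fun i => x (SmallSubset.singleton hk i)) ∈ A)) :
    ∀ᵐ p : (SmallSubset k → unitInterval) × unitInterval,
      (IsTopType (f p.1 p.2) ∨ IsBotType (f p.1 p.2)) ∧
        (IsTopType (f p.1 p.2) ↔ (fun i => p.1 (SmallSubset.singleton hk i)) ∈ A) := by
  have hm : ∀ B : Set (QfType (hypergraphLang k) k), MeasurableSet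
      {p : (SmallSubset k → unitInterval) × unitInterval | f p.1 p.2 ∈ B} := fun B =>
    hf.1 (QfType.measurableSet_of_hypergraphLang B)
  have hA' : MeasurableSet {p : (SmallSubset k → unitInterval) × unitInterval |
      (fun i => p.1 (SmallSubset.singleton hk i)) ∈ A} := by
    refine measurableSet_preimage ?_ hA
    fun_prop
  refine (Measure.ae_prod_iff_ae_ae ?_).2 ?_
  · exact ((hm {u | IsTopType u}).union (hm {u | IsBotType u})).inter
      ((hm {u | IsTopType u}).iff hA')
  · filter_upwards [h] with x ⟨u, hu, hx, hux⟩
    have hfx : Measurable (f x) := hf.1.comp measurable_prodMk_left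
    have h' : ∀ᵐ v ∂(volume.map (f x)), v = u := by
      rw [hf.2 x, hx]
      exact (ae_dirac_iff (measurableSet_singleton u)).2 rfl
    filter_upwards [ae_of_ae_map hfx.aemeasurable h'] with z hz
    simp only [hz]
    exact ⟨hu, hux⟩

/-! ### The sampled structure -/

theorem tauImage_injective {k : ℕ} (J : Finset ℕ) (hJ : J.card = k) :
    Function.Injective (tauImage J hJ) := fun _ _ h =>
  Subtype.ext (Finset.map_injective _ (congrArg Subtype.val h))

theorem tauImage_ne {k : ℕ} (J : Finset ℕ) (hJ : J.card = k) (F : SmallSubset k) :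
    tauImage J hJ F ≠ ⟨J, hJ.le⟩ := fun h => by
  have h' := congrArg (fun D : NatSubset k => D.1.card) h
  simp only [tauImage, Finset.card_map, hJ] at h'
  exact F.2.ne h'

/-- The singleton `{m}`, as a set of at most `k` natural numbers. -/
def NatSubset.singleton {k : ℕ} (hk : 2 ≤ k) (m : ℕ) : NatSubset k :=
  ⟨{m}, by rw [Finset.card_singleton]; omega⟩

theorem NatSubset.singleton_injective {k : ℕ} (hk : 2 ≤ k) :
    Function.Injective (NatSubset.singleton hk) := fun _ _ h =>
  Finset.singleton_injective (congrArg Subtype.val h)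

theorem tauImage_singleton {k : ℕ} (hk : 2 ≤ k) (J : Finset ℕ) (hJ : J.card = k) (i : Fin k) :
    tauImage J hJ (SmallSubset.singleton hk i) = NatSubset.singleton hk (J.orderEmbOfFin hJ i) :=
  Subtype.ext (Finset.map_singleton _ _)

/-- The distribution of the independent uniform variables `ζ_D`. -/
noncomputable abbrev uniformLaw (k : ℕ) : Measure (NatSubset k → unitInterval) :=
  Measure.infinitePi fun _ => volume

/-- The sets `τ_J(F)` and `J` are pairwise distinct, so the variables that determine the type on `J`
are again independent and uniform. -/
theorem ae_uniformLaw_of_ae {k : ℕ} (J : Finset ℕ) (hJ : J.card = k)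
    {p : (SmallSubset k → unitInterval) × unitInterval → Prop} (h : ∀ᵐ q, p q) :
    ∀ᵐ x ∂uniformLaw k, p (fun F => x (tauImage J hJ F), x ⟨J, hJ.le⟩) := by
  have hmap := map_comp_prodMk_infinitePi_of_injective (volume : Measure unitInterval)
    (tauImage_injective J hJ) (tauImage_ne J hJ)
  refine ae_of_ae_map (p := p) (by fun_prop) ?_
  rw [hmap]
  exact h

theorem measurable_sampleStructure {k : ℕ}
    {f : (SmallSubset k → unitInterval) → unitInterval → QfType (hypergraphLang k) k}
    (hf : Measurable (Function.uncurry f)) : Measurable (sampleStructure f) := by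
  refine measurable_generateFrom ?_
  rintro _ ⟨n, R, t, rfl⟩
  have : sampleStructure f ⁻¹' {M | M.Holds R t} =
      ⋃ (J : Finset ℕ) (hJ : J.card = k) (s : Fin n → Fin k)
        (_ : ∀ i, t i = J.orderEmbOfFin hJ (s i)),
        {x | relFormula R s ∈ (f (fun F => x (tauImage J hJ F)) (x ⟨J, hJ.le⟩)).1} := by
    ext x
    simp only [Set.mem_iUnion, exists_prop]
    rfl
  rw [this]
  refine .iUnion fun J => .iUnion fun hJ => .iUnion fun s => .iUnion fun _ => ?_
  have hx : Measurable fun x : NatSubset k → unitInterval =>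
      ((fun F => x (tauImage J hJ F)), x ⟨J, hJ.le⟩) := by fun_prop
  exact (hf.comp hx) (QfType.measurableSet_mem _)

theorem measurable_restrict {L : FirstOrder.Language.{0, 0}} [L.IsRelational] (n : ℕ) :
    Measurable (Str.restrict (L := L) n) := by
  refine measurable_generateFrom ?_
  rintro _ ⟨m, R, t, rfl⟩
  exact MeasurableSpace.measurableSet_generateFrom ⟨m, R, fun i => (t i : ℕ), rfl⟩

theorem Str.ext_edge {k : ℕ} {α : Type} {M N : Str (hypergraphLang k) α}
    (h : ∀ t : Fin k → α, M.Holds (edgeSymbol k) t ↔ N.Holds (edgeSymbol k) t) : M = N := by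
  refine Structure.ext ?_ ?_
  · funext n F
    exact F.elim
  · funext n R t
    cases R
    exact propext (h t)

instance Str.instFinite (k n : ℕ) : Finite (Str (hypergraphLang k) (Fin n)) :=
  Finite.of_injective (fun M => {t | M.Holds (edgeSymbol k) t})
    fun _ _ h => Str.ext_edge fun t => Set.ext_iff.1 h t

instance Str.instMeasurableSingleton (k n : ℕ) :
    MeasurableSingletonClass (Str (hypergraphLang k) (Fin n)) where
  measurableSet_singleton M := by
    have : {M} = ⋂ t : Fin k → Fin n, {N : Str (hypergraphLang k) (Fin n) |
        N.Holds (edgeSymbol k) t ↔ M.Holds (edgeSymbol k) t} := by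
      ext N
      simp only [Set.mem_singleton_iff, Set.mem_iInter, Set.mem_ofPred_eq]
      exact ⟨fun h t => by rw [h], Str.ext_edge⟩
    rw [this]
    refine .iInter fun t => ?_
    have ht : MeasurableSet {N : Str (hypergraphLang k) (Fin n) | N.Holds (edgeSymbol k) t} :=
      MeasurableSpace.measurableSet_generateFrom ⟨k, edgeSymbol k, t, rfl⟩
    by_cases hM : M.Holds (edgeSymbol k) t
    · simpa only [hM, iff_true] using ht
    · simp only [hM, iff_false]
      exact ht.compl

/-! ### Coding a random hypergraph by vertex classes and exceptional edges -/

/-- The `k`-element subsets of `{0, …, n-1}`. -/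
abbrev EdgeIndex (k n : ℕ) : Type := {J : Finset ℕ // J ∈ (Finset.range n).powersetCard k}

theorem EdgeIndex.card_eq {k n : ℕ} (J : EdgeIndex k n) : J.1.card = k :=
  (Finset.mem_powersetCard.1 J.2).2

/-- The increasing enumeration of `J`, as a map to `{0, …, n-1}`. -/
def EdgeIndex.enum {k n : ℕ} (J : EdgeIndex k n) (i : Fin k) : Fin n :=
  ⟨J.1.orderEmbOfFin J.card_eq i, Finset.mem_range.1
    ((Finset.mem_powersetCard.1 J.2).1 (Finset.orderEmbOfFin_mem _ _ _))⟩

theorem EdgeIndex.fintype_card (k n : ℕ) : Fintype.card (EdgeIndex k n) = n.choose k := by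
  rw [Fintype.card_coe, Finset.card_powersetCard, Finset.card_range]

/-- The hypergraph on `{0, …, n-1}` whose edges are the sets `J` for which exactly one of the
following holds: the classes of the elements of `J` form a tuple in `B`, and `J` is exceptional. -/
def decodeHypergraph {k n : ℕ} {α : Type} (B : Set (Fin k → α))
    (p : (Fin n → α) × (EdgeIndex k n → Bool)) : Str (hypergraphLang k) (Fin n) :=
  show (hypergraphLang k).Structure (Fin n) from
    { funMap := fun g => isEmptyElim g
      RelMap := fun {m} _ t => ∃ (J : EdgeIndex k n) (s : Fin m → Fin k),
        Function.Bijective s ∧ (∀ i, t i = J.enum (s i)) ∧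
          (p.1 ∘ J.enum ∈ B ↔ p.2 J = false) }

/-- When every type is `u_⊤` or `u_⊥`, one bit per `k`-set determines the structure. This is the
step that makes the restriction a function of a finite code. -/
theorem restrict_sampleStructure_eq_decodeHypergraph {k n : ℕ} {α : Type} {B : Set (Fin k → α)}
    {f : (SmallSubset k → unitInterval) → unitInterval → QfType (hypergraphLang k) k}
    {x : NatSubset k → unitInterval} {p : (Fin n → α) × (EdgeIndex k n → Bool)}
    (h : ∀ J : EdgeIndex k n,
      let u := f (fun F => x (tauImage J.1 J.card_eq F)) (x ⟨J.1, J.card_eq.le⟩)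
      (IsTopType u ∨ IsBotType u) ∧ (IsTopType u ↔ (p.1 ∘ J.enum ∈ B ↔ p.2 J = false))) :
    (sampleStructure f x).restrict n = decodeHypergraph B p := by
  refine Str.ext_edge fun t => ?_
  constructor
  · rintro ⟨J, hJ, s, hs, hu⟩
    have hinj : Function.Injective s := by
      obtain ⟨A, M, v, hM, hv, huv⟩ := QfType.exists_realization
        (f (fun F => x (tauImage J hJ F)) (x ⟨J, hJ.le⟩))
      rw [huv] at hu
      exact Function.Injective.of_comp (hM _ _ _ ((M.sat_rel _ _ _).1 hu.2))
    have hbij := Finite.injective_iff_bijective.1 hinj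
    -- As `s` is onto, every element of `J` is an entry of `t`, hence less than `n`.
    have hJn : J ∈ (Finset.range n).powersetCard k := by
      refine Finset.mem_powersetCard.2 ⟨fun m hm => ?_, hJ⟩
      rw [← Finset.mem_coe, ← Finset.range_orderEmbOfFin J hJ] at hm
      obtain ⟨i, rfl⟩ := hm
      obtain ⟨j, rfl⟩ := hbij.2 i
      rw [← hs, Finset.mem_range]
      exact (t j).2
    obtain ⟨h1, h2⟩ := h ⟨J, hJn⟩
    exact ⟨⟨J, hJn⟩, s, hbij, fun i => Fin.ext (hs i),
      h2.1 ((QfType.relFormula_edge_mem_iff h1 s).1 hu).2⟩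
  · rintro ⟨J, s, hs, ht, hJ⟩
    exact ⟨J.1, J.card_eq, s, fun i => congrArg Fin.val (ht i),
      (QfType.relFormula_edge_mem_iff (h J).1 s).2 ⟨hs, (h J).2.2 hJ⟩⟩

/-- The weight of a code: classes are uniform, and sets are exceptional with probability `ε`, all
independently. -/
noncomputable def codeWeight {ι κ : Type*} [Fintype κ] (a ε : ℝ) (m : ℕ)
    (p : ι × (κ → Bool)) : ℝ :=
  (a⁻¹) ^ m * ∏ J, if p.2 J then ε else 1 - ε

theorem codeWeight_pos {ι κ : Type*} [Fintype κ] {a ε : ℝ} (ha : 0 < a) (hε : 0 < ε) (hε1 : ε < 1)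
    (m : ℕ) (p : ι × (κ → Bool)) : 0 < codeWeight a ε m p := by
  refine mul_pos (by positivity) (Finset.prod_pos fun J _ => ?_)
  split_ifs <;> linarith

theorem sum_codeWeight {α κ : Type*} [Fintype α] [Nonempty α] [Fintype κ] [DecidableEq κ]
    (ε : ℝ) (n : ℕ) :
    ∑ p : (Fin n → α) × (κ → Bool), codeWeight (Fintype.card α) ε n p = 1 := by
  have hprod : ∑ D : κ → Bool, ∏ J, (if D J then ε else 1 - ε) = 1 := by
    rw [← Fintype.prod_sum fun (_ : κ) (b : Bool) => if b then ε else 1 - ε]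
    simp
  simp only [codeWeight, Fintype.sum_prod_type, ← Finset.mul_sum, hprod]
  rw [Finset.sum_const, Finset.card_univ, Fintype.card_fun, Fintype.card_fin, nsmul_eq_mul,
    Nat.cast_pow, mul_one, ← mul_pow, inv_mul_cancel₀ (by simp), one_pow]

/-- Charging `-log₂ (1 - ε)` also to exceptional sets loses little and makes the bound affine in the
exception indicators, so its mean is controlled by their probabilities. -/
theorem neg_logb_codeWeight_le {ι κ : Type*} [Fintype κ] {a ε : ℝ} (ha : 0 < a) (hε : 0 < ε)
    (hε1 : ε < 1) (m : ℕ) (p : ι × (κ → Bool)) :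
    -Real.logb 2 (codeWeight a ε m p) ≤ m * Real.logb 2 a +
      ∑ J, ((if p.2 J then 1 else 0) * -Real.logb 2 ε + -Real.logb 2 (1 - ε)) := by
  have hpos : ∀ J, 0 < if p.2 J then ε else 1 - ε := fun J => by split_ifs <;> linarith
  rw [codeWeight, Real.logb_mul (by positivity) (Finset.prod_pos fun J _ => hpos J).ne',
    Real.logb_pow, Real.logb_inv, Real.logb_prod _ _ fun J _ => (hpos J).ne', neg_add,
    ← Finset.sum_neg_distrib]
  refine add_le_add (by linarith) (Finset.sum_le_sum fun J _ => ?_)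
  have := Real.logb_nonpos one_lt_two (by linarith : 0 ≤ 1 - ε) (by linarith)
  split_ifs <;> linarith

/-! ### The growth of the entropy function -/

-- The constant `C` is the logarithm of the number of classes; it depends on `ε` but not on `n`.
open scoped symmDiff in
theorem entropyFunction_sampleLaw_le {k : ℕ} (hk : 2 ≤ k)
    {W : ExtHypergraphon (hypergraphLang k) k} (hW : W.InducesBorelHypergraph)
    {f : (SmallSubset k → unitInterval) → unitInterval → QfType (hypergraphLang k) k}
    (hf : W.IsRepresentedBy f) {ε : ℝ} (hε : 0 < ε) (hε1 : ε < 1) :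
    ∃ C : ℝ, 0 ≤ C ∧ ∀ n : ℕ, entropyFunction (sampleLaw f) n ≤ ENNReal.ofReal
      (n * C + n.choose k * (ε * -Real.logb 2 ε + -Real.logb 2 (1 - ε))) := by
  classical
  obtain ⟨A, hA, hWA⟩ := hW.exists_vertex_relation hk
  -- The same `ε` serves as approximation error here and as exception probability in `codeWeight`.
  obtain ⟨α, _, _, c, B, hc, hB⟩ := exists_finite_partition_approx
    (volume : Measure (Fin k → unitInterval)) hA (ENNReal.ofReal_pos.2 hε)
  have := Fintype.ofFinite α
  let : MeasurableSpace α := ⊤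
  have hcm : Measurable c := fun s _ => hc s
  have hcard : (1 : ℝ) ≤ Fintype.card α := by exact_mod_cast Fintype.card_pos
  refine ⟨Real.logb 2 (Fintype.card α), Real.logb_nonneg one_lt_two hcard, fun n => ?_⟩
  let ver : EdgeIndex k n → (NatSubset k → unitInterval) → Fin k → unitInterval :=
    fun J x i => x (NatSubset.singleton hk (J.enum i))
  have hver : ∀ J, Measurable (ver J) := fun J => by fun_prop
  let exc : Set (Fin k → unitInterval) := {v | c ∘ v ∈ B} ∆ A
  have hexc : MeasurableSet exc := by
    have hcv : Measurable fun v : Fin k → unitInterval => c ∘ v :=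
      measurable_pi_lambda _ fun i => hcm.comp (measurable_pi_apply i)
    exact (hcv (Set.toFinite B).measurableSet).symmDiff hA
  let Y : (NatSubset k → unitInterval) → (Fin n → α) × (EdgeIndex k n → Bool) := fun x =>
    (fun i => c (x (NatSubset.singleton hk i)), fun J => decide (ver J x ∈ exc))
  have hY : Measurable Y := by
    refine Measurable.prodMk ?_ ?_
    · exact measurable_pi_lambda _ fun i => hcm.comp (measurable_pi_apply _)
    · refine measurable_pi_lambda _ fun J => measurable_to_bool ?_
      convert! hver J hexc using 1
      ext x
      simp
  have hX : Str.restrict n ∘ sampleStructure f =ᵐ[uniformLaw k] decodeHypergraph B ∘ Y := by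
    have hall := ae_all_iff.2 fun J : EdgeIndex k n =>
      ae_uniformLaw_of_ae J.1 J.card_eq (hf.ae_isTopType_iff hk hA hWA)
    filter_upwards [hall] with x hx
    refine restrict_sampleStructure_eq_decodeHypergraph fun J => ?_
    obtain ⟨h1, h2⟩ := hx J
    refine ⟨h1, h2.trans ?_⟩
    simp only [tauImage_singleton]
    -- Flipping the prediction `c ∘ v ∈ B` exactly on the symmetric difference gives back membership
    -- in `A`.
    change ver J x ∈ A ↔ (c ∘ ver J x ∈ B ↔ decide (ver J x ∈ exc) = false)
    rw [decide_eq_false_iff_not, Set.mem_symmDiff, Set.mem_ofPred_eq]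
    tauto
  have hexcP : ∀ J, (uniformLaw k).real (ver J ⁻¹' exc) ≤ ε := by
    intro J
    -- Distinct vertices of `J` carry independent variables, so the vertex tuple is uniform and the
    -- approximation error applies to it.
    have hinj : Function.Injective fun i => NatSubset.singleton hk (J.enum i : ℕ) :=
      (NatSubset.singleton_injective hk).comp (J.1.orderEmbOfFin J.card_eq).injective
    have hmap := map_comp_infinitePi_of_injective (volume : Measure unitInterval) hinj
    have : (uniformLaw k) (ver J ⁻¹' exc) < ENNReal.ofReal ε := by
      rw [← Measure.map_apply (hver J) hexc, show (uniformLaw k).map (ver J) = volume from hmap]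
      exact hB
    exact ENNReal.toReal_le_of_le_ofReal hε.le this.le
  have hlog : 0 ≤ -Real.logb 2 ε := neg_nonneg.2 (Real.logb_nonpos one_lt_two hε.le hε1.le)
  have hexcI : ∀ J, Integrable (fun x => (if (Y x).2 J then (1 : ℝ) else 0)) (uniformLaw k) ∧
      ∫ x, (if (Y x).2 J then (1 : ℝ) else 0) ∂(uniformLaw k) =
        (uniformLaw k).real (ver J ⁻¹' exc) := by
    intro J
    have : (fun x => if (Y x).2 J then (1 : ℝ) else 0) = (ver J ⁻¹' exc).indicator 1 := by
      ext x
      simp [Y, Set.indicator]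
    rw [this]
    exact ⟨(integrable_const 1).indicator (hver J hexc), integral_indicator_one (hver J hexc)⟩
  have hint : ∀ J ∈ Finset.univ, Integrable (fun x =>
      (if (Y x).2 J then (1 : ℝ) else 0) * -Real.logb 2 ε + -Real.logb 2 (1 - ε))
        (uniformLaw k) := fun J _ => ((hexcI J).1.mul_const _).add (integrable_const _)
  rw [entropyFunction, sampleLaw,
    Measure.map_map (measurable_restrict n) (measurable_sampleStructure hf.1)]
  refine (measureEntropy_map_le_of_weights (uniformLaw k) Y hY (decodeHypergraph B) _ hX
    (codeWeight (Fintype.card α) ε n) (codeWeight_pos (by linarith) hε hε1 n)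
    (sum_codeWeight ε n).le).trans (ENNReal.ofReal_le_ofReal ?_)
  calc ∫ x, -Real.logb 2 (codeWeight (Fintype.card α) ε n (Y x)) ∂(uniformLaw k)
      ≤ ∫ x, (n * Real.logb 2 (Fintype.card α) + ∑ J, ((if (Y x).2 J then (1 : ℝ) else 0) *
          -Real.logb 2 ε + -Real.logb 2 (1 - ε))) ∂(uniformLaw k) := by
        refine integral_mono ?_ ((integrable_const _).add (integrable_finsetSum _ hint))
          fun x => neg_logb_codeWeight_le (by linarith) hε hε1 n _
        -- The integrand factors through `Y`, which takes finitely many values, so it is integrable.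
        have := Measure.isProbabilityMeasure_map (μ := uniformLaw k) hY.aemeasurable
        exact (Integrable.of_finite (μ := (uniformLaw k).map Y)
          (f := fun p => -Real.logb 2 (codeWeight (Fintype.card α) ε n p))).comp_measurable hY
    _ = n * Real.logb 2 (Fintype.card α) + ∑ J, ((uniformLaw k).real (ver J ⁻¹' exc) *
          -Real.logb 2 ε + -Real.logb 2 (1 - ε)) := by
        rw [integral_add (integrable_const _) (integrable_finsetSum _ hint),
          integral_finsetSum _ hint]
        simp only [integral_const, probReal_univ, one_smul]
        congr 1
        refine Finset.sum_congr rfl fun J _ => ?_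
        rw [integral_add ((hexcI J).1.mul_const _) (integrable_const _), integral_mul_const,
          (hexcI J).2, integral_const, probReal_univ, one_smul]
    _ ≤ n * Real.logb 2 (Fintype.card α) + ∑ _J : EdgeIndex k n,
          (ε * -Real.logb 2 ε + -Real.logb 2 (1 - ε)) := by
        gcongr with J
        exact hexcP J
    _ = _ := by
        rw [Finset.sum_const, Finset.card_univ, EdgeIndex.fintype_card, nsmul_eq_mul]

/-- The expression is continuous at `0` with value `0`, because `Real.negMulLog` is continuous
there. -/
theorem exists_binary_entropy_bound_lt {δ : ℝ} (hδ : 0 < δ) :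
    ∃ ε : ℝ, 0 < ε ∧ ε < 1 ∧ ε * -Real.logb 2 ε + -Real.logb 2 (1 - ε) < δ := by
  have h0 : Tendsto (fun ε : ℝ => ε * -Real.logb 2 ε + -Real.logb 2 (1 - ε)) (nhds 0) (nhds 0) := by
    have h1 : ContinuousAt (fun ε : ℝ => Real.negMulLog ε / Real.log 2) 0 :=
      Real.continuous_negMulLog.continuousAt.div_const _
    have h2 : ContinuousAt (fun ε : ℝ => -Real.log (1 - ε) / Real.log 2) 0 :=
      ((ContinuousAt.log (by fun_prop) (by norm_num)).neg).div_const _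
    have h3 : Tendsto (fun ε : ℝ => Real.negMulLog ε / Real.log 2 + -Real.log (1 - ε) / Real.log 2)
        (nhds 0) (nhds 0) := by
      convert! (h1.add h2).tendsto using 2
      simp
    refine h3.congr fun ε => ?_
    simp only [Real.negMulLog, Real.logb]
    ring
  have h := (h0.eventually (gt_mem_nhds hδ)).filter_mono (nhdsWithin_le_nhds (s := Set.Ioi 0))
  obtain ⟨ε, hε, hε'⟩ := (h.and (Ioo_mem_nhdsGT (zero_lt_one (α := ℝ)))).exists
  exact ⟨ε, hε'.1, hε'.2, hε⟩

theorem mainTheorem4 (k : ℕ) (hk : 2 ≤ k) (W : ExtHypergraphon (hypergraphLang k) k)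
    (hW : W.InducesBorelHypergraph)
    (f : (SmallSubset k → unitInterval) → unitInterval → QfType (hypergraphLang k) k)
    (hf : W.IsRepresentedBy f) :
    (∀ n : ℕ, entropyFunction (sampleLaw f) n ≠ ⊤) ∧
      (fun n : ℕ => (entropyFunction (sampleLaw f) n).toReal) =o[atTop]
        (fun n : ℕ => (n : ℝ) ^ k) := by
  refine ⟨fun n => ?_, isLittleO_iff.2 fun δ hδ => ?_⟩
  -- Finiteness needs only one value of `ε`; `1/2` is an arbitrary choice.
  · obtain ⟨C, -, h⟩ := entropyFunction_sampleLaw_le hk hW hf one_half_pos one_half_lt_one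
    exact ne_top_of_le_ne_top ENNReal.ofReal_ne_top (h n)
  · obtain ⟨ε, hε, hε1, hεδ⟩ := exists_binary_entropy_bound_lt (half_pos hδ)
    obtain ⟨C, hC, h⟩ := entropyFunction_sampleLaw_le hk hW hf hε hε1
    -- Half of `δ` pays for the classes and half for the exceptions. The threshold `2 * C / δ` gives
    -- `n * C ≤ δ / 2 * n ^ 2`, and `n ^ 2 ≤ n ^ k` uses `1 ≤ n` and `2 ≤ k`.
    filter_upwards [eventually_ge_atTop 1, eventually_ge_atTop ⌈2 * C / δ⌉₊] with n hn1 hn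
    have hn1' : (1 : ℝ) ≤ n := by exact_mod_cast hn1
    have hlin : n * C ≤ δ / 2 * (n : ℝ) ^ k := by
      have hCn : C ≤ δ / 2 * n := by
        have := (div_le_iff₀ hδ).1 (Nat.ceil_le.1 hn)
        linarith
      calc n * C ≤ n * (δ / 2 * n) := by gcongr
        _ = δ / 2 * (n : ℝ) ^ 2 := by ring
        _ ≤ δ / 2 * (n : ℝ) ^ k := by gcongr
    have hchoose : n.choose k * (ε * -Real.logb 2 ε + -Real.logb 2 (1 - ε)) ≤
        δ / 2 * (n : ℝ) ^ k := by
      calc _ ≤ n.choose k * (δ / 2) := by gcongr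
        _ ≤ (n : ℝ) ^ k * (δ / 2) := by
          gcongr
          exact_mod_cast Nat.choose_le_pow n k
        _ = δ / 2 * (n : ℝ) ^ k := mul_comm _ _
    rw [Real.norm_of_nonneg ENNReal.toReal_nonneg, Real.norm_of_nonneg (by positivity)]
    refine ENNReal.toReal_le_of_le_ofReal (by positivity)
      ((h n).trans (ENNReal.ofReal_le_ofReal ?_))
    linarith
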